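/- Let $\alpha>0$, let $n$ be the integer with $n-1<\alpha\le n$, let $m\ge 0$ be an integer and let $r\in\mathbb{R}$. Call $f:\mathbb{R}\to\mathbb{R}$ admissible if $f\in C^{m+n+1}(\mathbb{R})$ and $f^{(k)}\in L^1(\mathbb{R})$ for $0\le k\le m+n+1$. For a real sequence $w=(w_k)_{k\ge0}$ and $h>0$ put $$\Delta_{\mp h,r}^{\alpha}f(x)=\frac1{h^\alpha}\sum_{k=0}^\infty w_k\, f\bigl(x\mp(k-r)h\bigr),$$ and let $${}_{-\infty}D_x^\alpha f(x)=\lim_{h\to0^+}\frac1{h^\alpha}\sum_{k=0}^\infty(-1)^k\binom{\alpha}{k}f(x-kh),\qquad {}_xD_\infty^\alpha f(x)=\lim_{h\to0^+}\frac1{h^\alpha}\sum_{k=0}^\infty(-1)^k\binom{\alpha}{k}f(x+kh)$$ be the left and right Grünwald–Letnikov derivatives. Say that $w$ (or its generating function $W(z)=\sum_{k\ge0} w_kz^k$) approximates the fractional derivative of order $\alpha$ with shift $r$ if, for every admissible $f$ and every $x\in\mathbb{R}$, the series $\Delta_{\mp h,r}^{\alpha}f(x)$ converge for all sufficiently small $h>0$,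 the two Grünwald–Letnikov derivatives exist at $x$, and $$\lim_{h\to0^+}\Delta_{-h,r}^{\alpha}f(x)={}_{-\infty}D_x^\alpha f(x),\qquad \lim_{h\to0^+}\Delta_{+h,r}^{\alpha}f(x)={}_xD_\infty^\alpha f(x).$$ Let $p\ge0$ be an integer and $\beta_0,\dots,\beta_p\in\mathbb{R}$, and let $w$ be a real sequence whose generating function is $$W(z)=\sum_{k=0}^\infty w_kz^k=(\beta_0+\beta_1z+\cdots+\beta_pz^p)^\alpha$$ for all sufficiently small real $z>0$ (principal value of the power). If $W$ approximates the fractional derivative of order $\alpha$ with shift $r$, then $$\beta_0+\beta_1+\cdots+\beta_p=0.$$ -/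

import Mathlib

open Filter Topology MeasureTheory

noncomputable section

/-- The `N`-th partial sum of the Grünwald type difference operator with weights `w`, order `α`,
shift `r` and step `h`, namely `h ^ (-α) * ∑_{k < N} w k * f (x - σ * (k - r) * h)`;
`σ = 1` gives the left operator and `σ = -1` the right one. -/
def grunwaldPartial (σ : ℝ) (w : ℕ → ℝ) (α r : ℝ) (f : ℝ → ℝ) (x h : ℝ) (N : ℕ) : ℝ :=
  1 / h ^ α * ∑ k ∈ Finset.range N, w k * f (x - σ * ((k : ℝ) - r) * h)

/-- For all sufficiently small `h > 0` the series defining the Grünwald type operator converges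
(its sum being called `Δ h`), and `Δ h` tends to `d` as `h` decreases to `0`. -/
def GrunwaldTendsto (σ : ℝ) (w : ℕ → ℝ) (α r : ℝ) (f : ℝ → ℝ) (x d : ℝ) : Prop :=
  ∃ Δ : ℝ → ℝ,
    (∀ᶠ h in 𝓝[>] (0 : ℝ), Tendsto (grunwaldPartial σ w α r f x h) atTop (𝓝 (Δ h))) ∧
    Tendsto Δ (𝓝[>] (0 : ℝ)) (𝓝 d)

/-- The Grünwald weights `(-1) ^ k * binom(α, k)`. -/
def glWeight (α : ℝ) (k : ℕ) : ℝ := (-1) ^ k * Ring.choose α k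

/-- The left Grünwald-Letnikov derivative of order `α` of `f` at `x` exists and equals `d`. -/
def HasLeftGLDeriv (α : ℝ) (f : ℝ → ℝ) (x d : ℝ) : Prop :=
  GrunwaldTendsto 1 (glWeight α) α 0 f x d

/-- The right Grünwald-Letnikov derivative of order `α` of `f` at `x` exists and equals `d`. -/
def HasRightGLDeriv (α : ℝ) (f : ℝ → ℝ) (x d : ℝ) : Prop :=
  GrunwaldTendsto (-1) (glWeight α) α 0 f x d

/-- The real sequence `w` approximates the left and the right fractional derivatives of order `α`
of `f` at `x` with shift `r`, in the sense of Grünwald. -/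
def ApproximatesAt (w : ℕ → ℝ) (α r : ℝ) (f : ℝ → ℝ) (x : ℝ) : Prop :=
  (∃ d, HasLeftGLDeriv α f x d ∧ GrunwaldTendsto 1 w α r f x d) ∧
  (∃ d, HasRightGLDeriv α f x d ∧ GrunwaldTendsto (-1) w α r f x d)

/-- `f` is of class `C^s` on the line and its derivatives of orders `0, …, s` are integrable. -/
def IsAdmissible (s : ℕ) (f : ℝ → ℝ) : Prop :=
  ContDiff ℝ s f ∧ ∀ k ≤ s, Integrable (iteratedDeriv k f) volume

/-- The sequence `w` approximates the fractional derivatives of order `α` with shift `r`: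
it does so at every point for every admissible function of class `C^s`. -/
def ApproximatesFractionalDeriv (s : ℕ) (w : ℕ → ℝ) (α r : ℝ) : Prop :=
  ∀ f : ℝ → ℝ, IsAdmissible s f → ∀ x : ℝ, ApproximatesAt w α r f x

/-- The generating function `∑ w k * z ^ k` of `w` is `(β 0 + β 1 * z + ⋯ + β p * z ^ p) ^ α`.
The power is the principal complex power, so that integer `α` are covered whatever the sign of
`β 0`. The identity is asked for small positive real `z` only. This determines `w`;
for `β 0 > 0` it says that `w` is the sequence of Taylor coefficients at `0`, and it still makes
sense when `β 0 = 0` and the power happens to be a power series in `z`. -/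
def IsPowerGenerated (p : ℕ) (β : ℕ → ℝ) (α : ℝ) (w : ℕ → ℝ) : Prop :=
  ∀ᶠ z : ℝ in 𝓝[>] (0 : ℝ),
    HasSum (fun k : ℕ => ((w k * z ^ k : ℝ) : ℂ))
      (((∑ i ∈ Finset.range (p + 1), β i * z ^ i : ℝ) : ℂ) ^ (α : ℂ))

end

noncomputable section

/-! Test the hypothesis on an admissible function equal to `exp` on the negative half-line. At `x =
-1` and small `h` the left operator is `exp (r * h - 1) / h ^ α * W (exp (-h))`, so its having a
finite limit forces `W` to converge on `(-1, 1)` and `W z → 0` as `z → 1` from the left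
(`GrunwaldTendsto.radius_and_tendsto`).

Let `B` be the polynomial with coefficients `β i`. The relation `|W| = |B| ^ α` is known only near
`0` on the right and must be carried to `1` past possible zeros of `B`
(`eval_one_eq_zero_of_abs_eq_rpow`). It gives `B * (W ^ 2)' = 2 * α * B' * W ^ 2`, which extends to
`(-1, 1)` by analyticity. If `B 1 ≠ 0`, then `W ^ 2 = a * |B| ^ (2 * α)` near `1`; the limit gives
`a = 0`, so `W` vanishes identically, contradicting the relation near `0`. -/

/-- A smooth function that equals `exp` on the negative half-line and vanishes beyond `1`. -/
def cutoffExp (x : ℝ) : ℝ := Real.exp x * Real.smoothTransition (1 - x)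

theorem cutoffExp_of_nonpos {x : ℝ} (hx : x ≤ 0) : cutoffExp x = Real.exp x := by
  rw [cutoffExp, Real.smoothTransition.one_of_one_le (by linarith), mul_one]

theorem cutoffExp_of_one_le {x : ℝ} (hx : 1 ≤ x) : cutoffExp x = 0 := by
  rw [cutoffExp, Real.smoothTransition.zero_of_nonpos (by linarith), mul_zero]

theorem contDiff_cutoffExp (s : ℕ) : ContDiff ℝ s cutoffExp := by
  have h : ContDiff ℝ s Real.smoothTransition := Real.smoothTransition.contDiff (n := (s : ℕ∞))
  exact Real.contDiff_exp.mul (h.comp (contDiff_const.sub contDiff_id))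

theorem integrable_iteratedDeriv_cutoffExp (k : ℕ) :
    Integrable (iteratedDeriv k cutoffExp) volume := by
  have hcont : Continuous (iteratedDeriv k cutoffExp) :=
    (contDiff_cutoffExp k).continuous_iteratedDeriv k le_rfl
  have hneg : IntegrableOn (iteratedDeriv k cutoffExp) (Set.Iio 0) := by
    refine ((integrableOn_exp_Iic 0).mono_set Set.Iio_subset_Iic_self).congr_fun
      (fun x hx => ?_) measurableSet_Iio
    have hev : cutoffExp =ᶠ[𝓝 x] Real.exp := by
      filter_upwards [Iio_mem_nhds hx] with y hy using cutoffExp_of_nonpos hy.le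
    rw [hev.iteratedDeriv_eq k, iteratedDeriv_eq_iterate, Real.iter_deriv_exp]
  have hmid : IntegrableOn (iteratedDeriv k cutoffExp) (Set.Icc 0 1) :=
    hcont.integrableOn_Icc
  have hpos : IntegrableOn (iteratedDeriv k cutoffExp) (Set.Ioi 1) := by
    refine IntegrableOn.congr_fun (f := fun _ => (0 : ℝ)) integrableOn_zero (fun x hx => ?_)
      measurableSet_Ioi
    have hev : cutoffExp =ᶠ[𝓝 x] fun _ => (0 : ℝ) := by
      filter_upwards [Ioi_mem_nhds hx] with y hy using cutoffExp_of_one_le hy.le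
    rw [hev.iteratedDeriv_eq k]
    exact (by simp : (0 : ℝ) = iteratedDeriv k (fun _ : ℝ => (0 : ℝ)) x)
  rw [← integrableOn_univ]
  refine ((hneg.union hmid).union hpos).mono_set (fun x _ => ?_)
  rcases lt_or_ge x 0 with h | h
  · exact Or.inl (Or.inl h)
  · rcases le_or_gt x 1 with h' | h'
    · exact Or.inl (Or.inr ⟨h, h'⟩)
    · exact Or.inr h'

theorem isAdmissible_cutoffExp (s : ℕ) : IsAdmissible s cutoffExp :=
  ⟨contDiff_cutoffExp s, fun k _ => integrable_iteratedDeriv_cutoffExp k⟩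

/-- If the partial sums of `∑ w k * t ^ k` converge for points `t < 1` arbitrarily close to `1`,
the power series has radius of convergence at least `1`. -/
theorem one_le_radius_ofScalars {w : ℕ → ℝ}
    (hw : ∃ᶠ t in 𝓝[<] (1 : ℝ), ∃ l,
      Tendsto (fun N => ∑ k ∈ Finset.range N, w k * t ^ k) atTop (𝓝 l)) :
    1 ≤ (FormalMultilinearSeries.ofScalars ℝ w).radius := by
  refine ENNReal.le_of_forall_nnreal_lt fun s hs => ?_
  have hs1 : (s : ℝ) < 1 := by exact_mod_cast hs
  have hev : ∀ᶠ t in 𝓝[<] (1 : ℝ), (s : ℝ) < t := nhdsWithin_le_nhds (Ioi_mem_nhds hs1)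
  obtain ⟨t, ⟨l, hl⟩, hst⟩ := (hw.and_eventually hev).exists
  lift t to NNReal using s.coe_nonneg.trans hst.le
  -- Terms of a convergent series tend to zero, which already bounds the radius below by `t`.
  have hterm : Tendsto (fun k => w k * (t : ℝ) ^ k) atTop (𝓝 0) := by
    have := ((tendsto_add_atTop_iff_nat 1).2 hl).sub hl
    simpa [Finset.sum_range_succ] using this
  have hrad : (t : ENNReal) ≤ (FormalMultilinearSeries.ofScalars ℝ w).radius := by
    refine FormalMultilinearSeries.le_radius_of_tendsto _ (l := 0) ?_
    have := hterm.norm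
    simp only [norm_mul, norm_pow, norm_zero, NNReal.norm_eq] at this
    simpa [FormalMultilinearSeries.ofScalars_norm] using this
  exact le_trans (ENNReal.coe_le_coe.2 (NNReal.coe_le_coe.1 hst.le)) hrad

theorem analyticOnNhd_tsum_of_one_le_radius {w : ℕ → ℝ}
    (hw : 1 ≤ (FormalMultilinearSeries.ofScalars ℝ w).radius) :
    AnalyticOnNhd ℝ (fun z => ∑' k, w k * z ^ k) (Set.Ioo (-1) 1) := by
  have hps := (FormalMultilinearSeries.ofScalars ℝ w).hasFPowerSeriesOnBall
    (zero_lt_one.trans_le hw)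
  have hfun : (FormalMultilinearSeries.ofScalars ℝ w).sum = fun z => ∑' k, w k * z ^ k := by
    funext z
    exact FormalMultilinearSeries.ofScalars_sum_eq w z
  rw [hfun] at hps
  refine hps.analyticOnNhd.mono fun z hz => ?_
  refine Metric.eball_subset_eball hw ?_
  have hz' : z ∈ Metric.ball (0 : ℝ) 1 := by
    simpa [abs_lt] using hz
  rw [← Metric.eball_ofReal] at hz'
  simpa using hz'

theorem summable_of_one_le_radius {w : ℕ → ℝ}
    (hw : 1 ≤ (FormalMultilinearSeries.ofScalars ℝ w).radius) {z : ℝ} (hz : |z| < 1) :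
    Summable fun k => w k * z ^ k := by
  have hz' : (‖z‖₊ : ENNReal) < (FormalMultilinearSeries.ofScalars ℝ w).radius := by
    refine lt_of_lt_of_le ?_ hw
    exact_mod_cast (show ‖z‖ < 1 from hz)
  refine Summable.of_norm ?_
  simpa [FormalMultilinearSeries.ofScalars_norm] using
    (FormalMultilinearSeries.ofScalars ℝ w).summable_norm_mul_pow hz'

/-- A function that is analytic on `(-1, 1)`, tends to `0` at `1` from the left, and agrees in
absolute value with a real power of a polynomial near `0` on the right, forces
that polynomial to vanish at `1`. -/
theorem eval_one_eq_zero_of_abs_eq_rpow {W : ℝ → ℝ} {B : Polynomial ℝ} {α : ℝ}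
    (hW : AnalyticOnNhd ℝ W (Set.Ioo (-1) 1))
    (hWB : ∀ᶠ z in 𝓝[>] (0 : ℝ), |W z| = |B.eval z| ^ α)
    (hlim : Tendsto W (𝓝[<] 1) (𝓝 0)) : B.eval 1 = 0 := by
  by_contra hB1
  have hB0 : B ≠ 0 := by
    rintro rfl
    simp at hB1
  have hBne : ∀ᶠ z in 𝓝[>] (0 : ℝ), B.eval z ≠ 0 := by
    have hfin : {z | B.eval z = 0}.Finite := Polynomial.finite_setOfPred_isRoot hB0
    -- `0` itself is taken out of the root set, since `B` may vanish there.
    have hmem : ({z | B.eval z = 0} \ {0})ᶜ ∈ 𝓝 (0 : ℝ) :=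
      (hfin.sdiff).isClosed.isOpen_compl.mem_nhds (by simp)
    filter_upwards [nhdsWithin_le_nhds hmem, self_mem_nhdsWithin] with z hz hz0 hzB
    exact hz ⟨hzB, (ne_of_gt hz0 : z ≠ 0)⟩
  have hunit : ∀ᶠ z in 𝓝[>] (0 : ℝ), z ∈ Set.Ioo (0 : ℝ) 1 := Ioo_mem_nhdsGT one_pos
  have hpre : IsPreconnected (Set.Ioo (-1 : ℝ) 1) := isPreconnected_Ioo
  have h0 : (0 : ℝ) ∈ Set.Ioo (-1 : ℝ) 1 := by norm_num
  have hright : 𝓝[>] (0 : ℝ) ≤ 𝓝[≠] 0 := nhdsWithin_mono _ fun x hx => ne_of_gt hx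
  have hBan (P : Polynomial ℝ) : AnalyticOnNhd ℝ (fun z => P.eval z) (Set.Ioo (-1) 1) :=
    (AnalyticOnNhd.eval_polynomial P).mono (Set.subset_univ _)
  -- Without division by `B` both sides are analytic on all of `(-1, 1)`, so zeros of `B` are no
  -- obstacle to the identity theorem.
  have hode : Set.EqOn (fun z => B.eval z * deriv (fun y => W y ^ 2) z)
      (fun z => 2 * α * B.derivative.eval z * W z ^ 2) (Set.Ioo (-1) 1) := by
    refine AnalyticOnNhd.eqOn_of_preconnected_of_frequently_eq (z₀ := 0)
      ((hBan B).mul (hW.pow 2).deriv) ((analyticOnNhd_const.mul (hBan B.derivative)).mul (hW.pow 2)) hpre h0 ?_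
    refine Frequently.filter_mono (Eventually.frequently ?_) hright
    filter_upwards [eventually_eventually_nhdsWithin.2 hWB,
      eventually_eventually_nhdsWithin.2 hBne, self_mem_nhdsWithin] with z hz hzB hz0
    rw [IsOpen.nhdsWithin_eq isOpen_Ioi hz0] at hz hzB
    have hzne : B.eval z ≠ 0 := hzB.self_of_nhds
    -- Squaring removes the unknown sign of `W`; `Real.log` is the logarithm of the absolute value,
    -- so `B` may be negative.
    have hsq : (fun y => W y ^ 2) =ᶠ[𝓝 z] fun y => Real.exp (2 * α * Real.log (B.eval y)) := by
      filter_upwards [hz, hzB] with y hy hyB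
      rw [← sq_abs, hy, Real.rpow_def_of_pos (abs_pos.2 hyB), Real.log_abs, ← Real.exp_nat_mul]
      congr 1
      push_cast
      ring
    have hder := (((B.hasDerivAt z).log hzne).const_mul (2 * α)).exp
    show B.eval z * deriv (fun y => W y ^ 2) z = 2 * α * B.derivative.eval z * W z ^ 2
    rw [hsq.deriv_eq, hder.deriv, show W z ^ 2 = _ from hsq.self_of_nhds]
    field_simp
  obtain ⟨c, hc1, hc⟩ : ∃ c < (1 : ℝ), ∀ z ∈ Set.Ioo c 1, B.eval z ≠ 0 := by
    have hev : ∀ᶠ z in 𝓝[<] (1 : ℝ), B.eval z ≠ 0 :=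
      nhdsWithin_le_nhds (B.continuous.continuousAt.eventually_ne hB1)
    obtain ⟨c, hc, hcs⟩ := (mem_nhdsLT_iff_exists_Ioo_subset).1 hev
    exact ⟨c, hc, fun z hz => hcs hz⟩
  -- The maximum with `0` keeps `(d, 1)` inside `(-1, 1)`.
  set d := max c 0 with hd
  have hd1 : d < 1 := max_lt hc1 one_pos
  have hdU : Set.Ioo d 1 ⊆ Set.Ioo (-1 : ℝ) 1 := fun z hz =>
    ⟨by have := (le_max_right c 0).trans_lt hz.1; linarith, hz.2⟩
  have hdB : ∀ z ∈ Set.Ioo d 1, B.eval z ≠ 0 := fun z hz =>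
    hc z ⟨(le_max_left c 0).trans_lt hz.1, hz.2⟩
  -- The quotient of `W ^ 2` by `|B| ^ (2 * α)` is constant, by the differential equation.
  have hQ : ∀ z ∈ Set.Ioo d 1,
      HasDerivAt (fun y => W y ^ 2 * Real.exp (-(2 * α) * Real.log (B.eval y))) 0 z := by
    intro z hz
    have h1 : HasDerivAt (fun y => W y ^ 2) (deriv (fun y => W y ^ 2) z) z :=
      ((hW.pow 2) z (hdU hz)).differentiableAt.hasDerivAt
    have h2 := (((B.hasDerivAt z).log (hdB z hz)).const_mul (-(2 * α))).exp
    refine (h1.mul h2).congr_deriv ?_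
    have h3 := hode (hdU hz)
    have h4 := hdB z hz
    simp only at h3
    generalize Real.exp (-(2 * α) * Real.log (B.eval z)) = e
    field_simp
    linear_combination e * h3
  obtain ⟨a, ha⟩ := isOpen_Ioo.exists_is_const_of_deriv_eq_zero isPreconnected_Ioo
    (fun z hz => (hQ z hz).differentiableAt.differentiableWithinAt)
    (fun z hz => (hQ z hz).deriv)
  have hnear : ∀ᶠ z in 𝓝[<] (1 : ℝ), z ∈ Set.Ioo d 1 := Ioo_mem_nhdsLT hd1
  have ha0 : a = 0 := by
    have hBlim : Tendsto (fun y => Real.exp (-(2 * α) * Real.log (B.eval y))) (𝓝[<] 1)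
        (𝓝 (Real.exp (-(2 * α) * Real.log (B.eval 1)))) :=
      (((B.continuous.continuousAt.log hB1).const_mul _).rexp).tendsto.mono_left
        nhdsWithin_le_nhds
    have hprod := (hlim.pow 2).mul hBlim
    rw [zero_pow two_ne_zero, zero_mul] at hprod
    refine tendsto_nhds_unique (Tendsto.congr' ?_ tendsto_const_nhds) hprod
    filter_upwards [hnear] with z hz using (ha z hz).symm
  have hWzero : Set.EqOn W 0 (Set.Ioo (-1) 1) := by
    obtain ⟨z₁, hz₁⟩ := Set.nonempty_Ioo.2 hd1
    refine hW.eqOn_of_preconnected_of_eventuallyEq analyticOnNhd_const hpre (hdU hz₁) ?_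
    filter_upwards [Ioo_mem_nhds hz₁.1 hz₁.2] with z hz
    have := ha z hz
    rw [ha0] at this
    exact pow_eq_zero_iff two_ne_zero |>.1
      ((mul_eq_zero.1 this).resolve_right (Real.exp_pos _).ne')
  obtain ⟨z, ⟨hz, hzB⟩, hzU⟩ := ((hWB.and hBne).and hunit).exists
  rw [hWzero ⟨by linarith [hzU.1], hzU.2⟩, Pi.zero_apply, abs_zero] at hz
  exact (Real.rpow_pos_of_pos (abs_pos.2 hzB) α).ne hz

/-- As `r * h ≤ 1`, every sample point `-1 - (k - r) * h` is nonpositive, where the test function is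
an exact exponential. -/
theorem grunwaldPartial_cutoffExp (w : ℕ → ℝ) (α r h : ℝ) (hh : 0 < h) (hr : r * h ≤ 1) (N : ℕ) :
    grunwaldPartial 1 w α r cutoffExp (-1) h N =
      Real.exp (r * h - 1) / h ^ α * ∑ k ∈ Finset.range N, w k * Real.exp (-h) ^ k := by
  rw [grunwaldPartial, div_mul_eq_mul_div, div_mul_eq_mul_div, one_mul, Finset.mul_sum]
  congr 1
  refine Finset.sum_congr rfl fun k _ => ?_
  have hkh : 0 ≤ (k : ℝ) * h := by positivity
  rw [cutoffExp_of_nonpos (by linarith), ← Real.exp_nat_mul, mul_left_comm, ← Real.exp_add]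
  congr 2
  ring

theorem tendsto_exp_neg_nhdsGT_zero :
    Tendsto (fun h : ℝ => Real.exp (-h)) (𝓝[>] 0) (𝓝[<] 1) := by
  refine tendsto_nhdsWithin_iff.2 ⟨?_, ?_⟩
  · have : Tendsto (fun h : ℝ => Real.exp (-h)) (𝓝 0) (𝓝 (Real.exp (-0))) :=
      (by fun_prop : Continuous fun h : ℝ => Real.exp (-h)).tendsto 0
    simpa using this.mono_left nhdsWithin_le_nhds
  · filter_upwards [self_mem_nhdsWithin] with h hh
    simpa using hh

theorem tendsto_neg_log_nhdsLT_one :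
    Tendsto (fun t : ℝ => -Real.log t) (𝓝[<] 1) (𝓝[>] 0) := by
  refine tendsto_nhdsWithin_iff.2 ⟨?_, ?_⟩
  · have := (Real.continuousAt_log one_ne_zero).neg.tendsto
    rw [Pi.neg_apply, Real.log_one, neg_zero] at this
    exact this.mono_left nhdsWithin_le_nhds
  · filter_upwards [Ioo_mem_nhdsLT one_pos] with t ht
    simpa using Real.log_neg ht.1 ht.2

/-- If the left Grünwald operator with weights `w`, applied to `cutoffExp` at `-1`, has a limit, then the generating function of `w` converges on
`(-1, 1)` and tends to `0` at `1`. -/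
theorem GrunwaldTendsto.radius_and_tendsto {w : ℕ → ℝ} {α r d : ℝ} (hα : 0 < α)
    (hG : GrunwaldTendsto 1 w α r cutoffExp (-1) d) :
    1 ≤ (FormalMultilinearSeries.ofScalars ℝ w).radius ∧
      Tendsto (fun z => ∑' k, w k * z ^ k) (𝓝[<] 1) (𝓝 0) := by
  obtain ⟨Δ, hΔ, hlim⟩ := hG
  have hsmall : ∀ᶠ h in 𝓝[>] (0 : ℝ), r * h ≤ 1 := by
    have : Tendsto (fun h => r * h) (𝓝 0) (𝓝 (r * 0)) := tendsto_id.const_mul r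
    rw [mul_zero] at this
    exact nhdsWithin_le_nhds (this.eventually (Iic_mem_nhds one_pos))
  have hsum : ∀ᶠ h in 𝓝[>] (0 : ℝ),
      Tendsto (fun N => ∑ k ∈ Finset.range N, w k * Real.exp (-h) ^ k) atTop
        (𝓝 (Real.exp (1 - r * h) * h ^ α * Δ h)) := by
    filter_upwards [hΔ, hsmall, self_mem_nhdsWithin] with h hh hr hpos
    refine (hh.const_mul (Real.exp (1 - r * h) * h ^ α)).congr fun N => ?_
    have hhα : h ^ α ≠ 0 := (Real.rpow_pos_of_pos hpos α).ne'
    rw [grunwaldPartial_cutoffExp w α r h hpos hr N, ← mul_assoc, mul_assoc (Real.exp _),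
      mul_div_cancel₀ _ hhα, ← Real.exp_add]
    simp
  have hrad : 1 ≤ (FormalMultilinearSeries.ofScalars ℝ w).radius := by
    refine one_le_radius_ofScalars (Frequently.filter_mono ?_ tendsto_exp_neg_nhdsGT_zero)
    exact (hsum.mono fun h hh => ⟨_, hh⟩).frequently
  refine ⟨hrad, ?_⟩
  have hexp : Tendsto (fun h => ∑' k, w k * Real.exp (-h) ^ k) (𝓝[>] 0) (𝓝 0) := by
    -- Here `0 < α` matters: `h ^ α → 0` while `Δ h` stays convergent.
    have hfac : Tendsto (fun h : ℝ => Real.exp (1 - r * h) * h ^ α) (𝓝[>] 0) (𝓝 0) := by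
      have h1 : ContinuousAt (fun h : ℝ => Real.exp (1 - r * h) * h ^ α) 0 :=
        ContinuousAt.mul (by fun_prop) (Real.continuousAt_rpow_const 0 α (Or.inr hα.le))
      have h2 := h1.tendsto.mono_left (nhdsWithin_le_nhds (s := Set.Ioi 0))
      simpa [Real.zero_rpow hα.ne'] using h2
    have hprod := hfac.mul hlim
    rw [zero_mul] at hprod
    refine hprod.congr' ?_
    filter_upwards [hsum, self_mem_nhdsWithin] with h hh hpos
    have habs : |Real.exp (-h)| < 1 := by
      rw [abs_of_pos (Real.exp_pos _)]
      simpa using hpos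
    exact tendsto_nhds_unique hh
      (summable_of_one_le_radius hrad habs).hasSum.tendsto_sum_nat
  refine (hexp.comp tendsto_neg_log_nhdsLT_one).congr' ?_
  filter_upwards [Ioo_mem_nhdsLT one_pos] with t ht
  simp [Real.exp_log ht.1]

/-- Taking norms discards the phase of the principal power when the base is negative. -/
theorem IsPowerGenerated.eventually_abs_tsum_eq {p : ℕ} {β : ℕ → ℝ} {α : ℝ} {w : ℕ → ℝ}
    (hw : IsPowerGenerated p β α w) :
    ∀ᶠ z in 𝓝[>] (0 : ℝ),
      |∑' k, w k * z ^ k| = |∑ i ∈ Finset.range (p + 1), β i * z ^ i| ^ α := by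
  filter_upwards [hw] with z hz
  have h := congrArg norm hz.tsum_eq
  rwa [← Complex.ofReal_tsum, Complex.norm_real, Complex.norm_cpow_real, Complex.norm_real] at h

end

theorem mainTheorem10 (α : ℝ) (hα : 0 < α) (n : ℕ) (hn : (n : ℝ) - 1 < α) (hn' : α ≤ n) (m : ℕ)
    (r : ℝ) (p : ℕ) (β : ℕ → ℝ) (w : ℕ → ℝ) (hw : IsPowerGenerated p β α w)
    (happrox : ApproximatesFractionalDeriv (m + n + 1) w α r) :
    ∑ i ∈ Finset.range (p + 1), β i = 0 := by
  obtain ⟨⟨d, _, hd⟩, _⟩ := happrox cutoffExp (isAdmissible_cutoffExp _) (-1)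
  obtain ⟨hrad, hlim⟩ := hd.radius_and_tendsto hα
  set B : Polynomial ℝ :=
    ∑ i ∈ Finset.range (p + 1), Polynomial.C (β i) * Polynomial.X ^ i with hB
  have heval (z : ℝ) : B.eval z = ∑ i ∈ Finset.range (p + 1), β i * z ^ i := by
    simp [hB, Polynomial.eval_finsetSum]
  have h1 := eval_one_eq_zero_of_abs_eq_rpow (B := B) (α := α)
    (analyticOnNhd_tsum_of_one_le_radius hrad)
    (by simpa only [heval] using hw.eventually_abs_tsum_eq) hlim
  simpa [heval] using h1
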